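/- Let $R$ be a finite commutative unital ring and let $\mathcal{B}$ be the category of commutative unital $R$-algebras. A *co-$\mathcal{B}$-object* in $\mathcal{B}$ is an $R$-algebra $A$ with an $R$-algebra map $\Delta_p : A \to A^{\otimes n}$ (tensor power over $R$, i.e. the $n$-fold coproduct) for every $n \ge 0$ and every $n$-ary operation $p \in R[X_1,\dots,X_n]$ of the theory of commutative $R$-algebras, such that $\Delta_{X_i}$ is the $i$-th coprojection and $\Delta_{p(q_1,\dots,q_n)} = [\Delta_{q_1},\dots,\Delta_{q_n}]\circ \Delta_p$; morphisms are the $R$-algebra maps commuting with all $\Delta_p$. Then $\mathrm{Hom}_{\mathcal B}(A,D)$ is naturally an $R$-algebra for every $D$. The co-$\mathcal{B}$-objects form a monoidal category $(\mathcal{B}^c\mathcal{B}, \odot, I)$: the product represents composition, $\mathrm{Hom}(A\odot B, D)\cong \mathrm{Hom}(A,\mathrm{Hom}(B,D))$, the universal map $A \to \mathrm{Hom}(B, A\odot B)$ being written $a\mapsto (b\mapsto a\odot b)$, and the unit is $I=R[X]$. A *Tall–Wraith $\mathcal{B}$-monoid* is a monoid $T$ in this monoidal category. A *$T$-module* in $\mathcal{B}$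 is an $R$-algebra $B$ with an $R$-algebra map $B\to\mathrm{Hom}_{\mathcal B}(T,B)$, $b\mapsto(t\mapsto t\cdot b)$, satisfying $\eta(X)\cdot b=b$ and $\mu(t\odot t')\cdot b = t'\cdot(t\cdot b)$, where $\eta : I\to T$ and $\mu : T\odot T\to T$ are the unit and the multiplication of $T$; morphisms of $T$-modules are the $R$-algebra maps that commute with the action. **Theorem.** Let $R^S$ denote the $R$-algebra of all functions $S \to R$. 1. For every $n\ge 0$ the $R$-algebra map $\kappa_n : (R^R)^{\otimes n} \to R^{R^n}$, whose restriction to the $i$-th factor is composition with the $i$-th projection $R^n\to R$, is an isomorphism. 2. $R^R$ is a co-$\mathcal{B}$-object with co-operations determined by $\kappa_n(\Delta_p(f)) = \big(x\mapsto f(p(x))\big)$ for $f \in R^R$, $p\in R[X_1,\dots,X_n]$. Composition of functions makes this co-$\mathcal{B}$-object a Tall–Wraith $\mathcal{B}$-monoid: it has a monoid structure with unit $\eta : R[X]\to R^R$, $X\mapsto \mathrm{id}_R$, and multiplication $\mu : R^R\odot R^R\to R^R$, $f\odot g\mapsto g\circ f$. 3. The contravariant functor $S\mapsto R^S$ from sets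 to $\mathcal{B}$ lifts to a functor from $\mathbf{Set}^{\mathrm{op}}$ to the category of $R^R$-modules in $\mathcal{B}$, where $g\in R^R$ acts on $h\in R^S$ by $g\cdot h = g\circ h$. -/

import Mathlib

open CategoryTheory MonoidalCategory Opposite
open scoped MonObj

universe u

namespace TallWraith

noncomputable section

/-! ### Finite coproducts of commutative algebras -/

section Coproducts

open scoped TensorProduct

variable {R A D E : Type*} [CommRing R] [CommRing A] [Algebra R A] [CommRing D] [Algebra R D]
  [CommRing E] [Algebra R E] {n : ℕ}

variable (R A) in
/-- The `n`-fold coproduct of `A` with itself in commutative `R`-algebras: the `n`-fold tensor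
power of `A` over `R`. -/
abbrev Pow (n : ℕ) : Type _ := ⨂[R] _ : Fin n, A

/-- The `i`-th coprojection `a ↦ 1 ⊗ ⋯ ⊗ a ⊗ ⋯ ⊗ 1`. -/
def inj (i : Fin n) : A →ₐ[R] Pow R A n :=
  PiTensorProduct.singleAlgHom (R := R) (A := fun _ : Fin n => A) i

/-- The algebra map out of the coproduct with components `φ i`, that is
`a₁ ⊗ ⋯ ⊗ aₙ ↦ φ₁ a₁ ⋯ φₙ aₙ`. -/
def desc (φ : Fin n → (A →ₐ[R] D)) : Pow R A n →ₐ[R] D :=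
  PiTensorProduct.liftAlgHom
    ((MultilinearMap.mkPiAlgebra R (Fin n) D).compLinearMap fun i => (φ i).toLinearMap)
    (by simp) (by intro x y; simp [Finset.prod_mul_distrib])

theorem desc_tprod (φ : Fin n → (A →ₐ[R] D)) (a : Fin n → A) :
    desc φ (PiTensorProduct.tprod R a) = ∏ i, φ i (a i) :=
  (PiTensorProduct.lift.tprod _).trans (by simp)

@[simp] theorem desc_comp_inj (φ : Fin n → (A →ₐ[R] D)) (i : Fin n) :
    (desc φ).comp (inj i) = φ i := by
  ext a
  have h : inj (R := R) i a = PiTensorProduct.tprod R (Pi.mulSingle i a) := rfl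
  rw [AlgHom.comp_apply, h, desc_tprod, Finset.prod_eq_single i]
  · simp
  · intro j _ hj; simp [Pi.mulSingle_eq_of_ne hj]
  · simp

@[simp] theorem desc_inj (φ : Fin n → (A →ₐ[R] D)) (i : Fin n) (a : A) :
    desc φ (inj i a) = φ i a :=
  DFunLike.congr_fun (desc_comp_inj φ i) a

theorem pow_hom_ext {f g : Pow R A n →ₐ[R] D} (h : ∀ i, f.comp (inj i) = g.comp (inj i)) :
    f = g :=
  PiTensorProduct.algHom_ext h

theorem comp_desc (f : D →ₐ[R] E) (φ : Fin n → (A →ₐ[R] D)) :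
    f.comp (desc φ) = desc fun i => f.comp (φ i) := by
  refine pow_hom_ext fun i => ?_
  rw [AlgHom.comp_assoc, desc_comp_inj, desc_comp_inj]

theorem desc_inj_eq_id : desc (fun i : Fin n => inj (R := R) (A := A) i) = AlgHom.id R _ :=
  pow_hom_ext fun i => by simp

theorem desc_comp_desc {B : Type*} [CommRing B] [Algebra R B] {m : ℕ}
    (ψ : Fin m → (B →ₐ[R] D)) (φ : Fin n → (A →ₐ[R] Pow R B m)) :
    (desc ψ).comp (desc φ) = desc fun i => (desc ψ).comp (φ i) :=
  comp_desc _ _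

end Coproducts

/-! ### Co-(commutative `R`-algebra) objects in commutative `R`-algebras -/

/-- A co-(commutative `R`-algebra) structure on a commutative `R`-algebra `A`. The `n`-ary
operations of the theory of commutative `R`-algebras are the polynomials
`p ∈ R[X₁, …, Xₙ]`; the projections are the variables, and composition of operations is
substitution of polynomials. A model of this theory in the opposite of the category of
commutative `R`-algebras with underlying object `A` consists of a co-operation
`A → A ⊗ ⋯ ⊗ A` for each `n`-ary operation, where projections go to coprojections and
composites go to composites. -/
class CoAlg (R A : Type*) [CommRing R] [CommRing A] [Algebra R A] where
  /-- the co-operation belonging to an `n`-ary operation -/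
  coop : ∀ {n : ℕ}, MvPolynomial (Fin n) R → (A →ₐ[R] Pow R A n)
  coop_X : ∀ {n : ℕ} (i : Fin n), coop (MvPolynomial.X i) = inj i
  coop_bind : ∀ {m n : ℕ} (p : MvPolynomial (Fin n) R) (q : Fin n → MvPolynomial (Fin m) R),
    coop (MvPolynomial.bind₁ q p) = (desc fun i => coop (q i)).comp (coop p)

/-- An algebra map between co-algebra objects that commutes with all co-operations. -/
def IsCoHom {R A B : Type*} [CommRing R] [CommRing A] [Algebra R A] [CoAlg R A]
    [CommRing B] [Algebra R B] [CoAlg R B] (f : A →ₐ[R] B) : Prop :=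
  ∀ (n : ℕ) (p : MvPolynomial (Fin n) R),
    (desc fun i => (inj i).comp f).comp (CoAlg.coop p) = (CoAlg.coop p).comp f

/-- The set of algebra maps `A → D`, where `A` is a co-algebra object. It carries the
`R`-algebra structure induced by the co-operations of `A` (see the instances below). -/
@[ext] structure CoHom (R A D : Type*) [CommRing R] [CommRing A] [Algebra R A]
    [CommRing D] [Algebra R D] where
  /-- the underlying algebra map -/
  hom : A →ₐ[R] D

namespace CoHom

section

variable {R A B D E : Type*} [CommRing R] [CommRing A] [Algebra R A] [CoAlg R A]
  [CommRing B] [Algebra R B] [CoAlg R B]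
  [CommRing D] [Algebra R D] [CommRing E] [Algebra R E]

/-- The operation on `Hom(A, D)` induced by the co-operation of `A` belonging to `p`:
`(φ₁, …, φₙ) ↦ [φ₁, …, φₙ] ∘ Δ_p`. -/
def op {n : ℕ} (p : MvPolynomial (Fin n) R) (φ : Fin n → CoHom R A D) : CoHom R A D :=
  ⟨(desc fun i => (φ i).hom).comp (CoAlg.coop p)⟩

theorem op_X {n : ℕ} (i : Fin n) (φ : Fin n → CoHom R A D) :
    op (MvPolynomial.X i) φ = φ i := by
  ext1; simp [op, CoAlg.coop_X]

theorem op_bind {m n : ℕ} (p : MvPolynomial (Fin n) R) (q : Fin n → MvPolynomial (Fin m) R)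
    (φ : Fin m → CoHom R A D) :
    op (MvPolynomial.bind₁ q p) φ = op p fun i => op (q i) φ := by
  ext1
  simp only [op, CoAlg.coop_bind]
  rw [← AlgHom.comp_assoc, desc_comp_desc]

instance : Zero (CoHom R A D) := ⟨op (n := 0) 0 Fin.elim0⟩
instance : One (CoHom R A D) := ⟨op (n := 0) 1 Fin.elim0⟩
instance : Add (CoHom R A D) :=
  ⟨fun a b => op (MvPolynomial.X 0 + MvPolynomial.X 1) ![a, b]⟩
instance : Mul (CoHom R A D) :=
  ⟨fun a b => op (MvPolynomial.X 0 * MvPolynomial.X 1) ![a, b]⟩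
instance : Neg (CoHom R A D) := ⟨fun a => op (-MvPolynomial.X 0) ![a]⟩

theorem op_add {n : ℕ} (p q : MvPolynomial (Fin n) R) (φ : Fin n → CoHom R A D) :
    op (p + q) φ = op p φ + op q φ := by
  have h := op_bind (MvPolynomial.X 0 + MvPolynomial.X 1) ![p, q] φ
  simp only [map_add, MvPolynomial.bind₁_X_right] at h
  refine h.trans (congrArg (op _) ?_)
  funext i; fin_cases i <;> rfl

theorem op_mul {n : ℕ} (p q : MvPolynomial (Fin n) R) (φ : Fin n → CoHom R A D) :
    op (p * q) φ = op p φ * op q φ := by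
  have h := op_bind (MvPolynomial.X 0 * MvPolynomial.X 1) ![p, q] φ
  simp only [map_mul, MvPolynomial.bind₁_X_right] at h
  refine h.trans (congrArg (op _) ?_)
  funext i; fin_cases i <;> rfl

theorem op_neg {n : ℕ} (p : MvPolynomial (Fin n) R) (φ : Fin n → CoHom R A D) :
    op (-p) φ = -op p φ := by
  have h := op_bind (-MvPolynomial.X 0) ![p] φ
  simp only [map_neg, MvPolynomial.bind₁_X_right] at h
  refine h.trans (congrArg (op _) ?_)
  funext i; fin_cases i; rfl

theorem op_zero {n : ℕ} (φ : Fin n → CoHom R A D) :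
    op (0 : MvPolynomial (Fin n) R) φ = 0 := by
  have h := op_bind (0 : MvPolynomial (Fin 0) R) Fin.elim0 φ
  simp only [map_zero] at h
  exact h.trans (congrArg (op _) (Subsingleton.elim _ _))

theorem op_one {n : ℕ} (φ : Fin n → CoHom R A D) :
    op (1 : MvPolynomial (Fin n) R) φ = 1 := by
  have h := op_bind (1 : MvPolynomial (Fin 0) R) Fin.elim0 φ
  simp only [map_one] at h
  exact h.trans (congrArg (op _) (Subsingleton.elim _ _))

/-- The constant `r` in `Hom(A, D)`. -/
def const (r : R) : CoHom R A D := op (n := 0) (MvPolynomial.C r) Fin.elim0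

theorem op_C {n : ℕ} (r : R) (φ : Fin n → CoHom R A D) :
    op (MvPolynomial.C r) φ = const r := by
  have h := op_bind (MvPolynomial.C r : MvPolynomial (Fin 0) R) Fin.elim0 φ
  simp only [MvPolynomial.bind₁_C_right] at h
  exact h.trans (congrArg (op _) (Subsingleton.elim _ _))

instance : CommRing (CoHom R A D) where
  add_assoc a b c := by
    have h := congrArg (fun p => op p ![a, b, c])
      (add_assoc (MvPolynomial.X 0 : MvPolynomial (Fin 3) R) (MvPolynomial.X 1) (MvPolynomial.X 2))
    simpa [op_add, op_X] using h
  zero_add a := by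
    have h := congrArg (fun p => op p ![a]) (zero_add (MvPolynomial.X 0 : MvPolynomial (Fin 1) R))
    simpa only [op_add, op_X, op_zero, Matrix.cons_val_zero] using h
  add_zero a := by
    have h := congrArg (fun p => op p ![a]) (add_zero (MvPolynomial.X 0 : MvPolynomial (Fin 1) R))
    simpa only [op_add, op_X, op_zero, Matrix.cons_val_zero] using h
  add_comm a b := by
    have h := congrArg (fun p => op p ![a, b])
      (add_comm (MvPolynomial.X 0 : MvPolynomial (Fin 2) R) (MvPolynomial.X 1))
    simpa [op_add, op_X] using h
  left_distrib a b c := by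
    have h := congrArg (fun p => op p ![a, b, c])
      (mul_add (MvPolynomial.X 0 : MvPolynomial (Fin 3) R) (MvPolynomial.X 1) (MvPolynomial.X 2))
    simpa [op_add, op_mul, op_X] using h
  right_distrib a b c := by
    have h := congrArg (fun p => op p ![a, b, c])
      (add_mul (MvPolynomial.X 0 : MvPolynomial (Fin 3) R) (MvPolynomial.X 1) (MvPolynomial.X 2))
    simpa [op_add, op_mul, op_X] using h
  zero_mul a := by
    have h := congrArg (fun p => op p ![a]) (zero_mul (MvPolynomial.X 0 : MvPolynomial (Fin 1) R))
    simpa only [op_mul, op_X, op_zero, Matrix.cons_val_zero] using h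
  mul_zero a := by
    have h := congrArg (fun p => op p ![a]) (mul_zero (MvPolynomial.X 0 : MvPolynomial (Fin 1) R))
    simpa only [op_mul, op_X, op_zero, Matrix.cons_val_zero] using h
  mul_assoc a b c := by
    have h := congrArg (fun p => op p ![a, b, c])
      (mul_assoc (MvPolynomial.X 0 : MvPolynomial (Fin 3) R) (MvPolynomial.X 1) (MvPolynomial.X 2))
    simpa [op_mul, op_X] using h
  one_mul a := by
    have h := congrArg (fun p => op p ![a]) (one_mul (MvPolynomial.X 0 : MvPolynomial (Fin 1) R))
    simpa only [op_mul, op_X, op_one, Matrix.cons_val_zero] using h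
  mul_one a := by
    have h := congrArg (fun p => op p ![a]) (mul_one (MvPolynomial.X 0 : MvPolynomial (Fin 1) R))
    simpa only [op_mul, op_X, op_one, Matrix.cons_val_zero] using h
  mul_comm a b := by
    have h := congrArg (fun p => op p ![a, b])
      (mul_comm (MvPolynomial.X 0 : MvPolynomial (Fin 2) R) (MvPolynomial.X 1))
    simpa [op_mul, op_X] using h
  neg_add_cancel a := by
    have h := congrArg (fun p => op p ![a])
      (neg_add_cancel (MvPolynomial.X 0 : MvPolynomial (Fin 1) R))
    simpa only [op_add, op_neg, op_X, op_zero, Matrix.cons_val_zero] using h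
  nsmul := nsmulRec
  zsmul := zsmulRec

instance : Algebra R (CoHom R A D) :=
  RingHom.toAlgebra
    { toFun := const
      map_zero' := by rw [const, map_zero, op_zero]
      map_one' := by rw [const, map_one, op_one]
      map_add' := fun r s => by simp only [const, map_add, op_add]
      map_mul' := fun r s => by simp only [const, map_mul, op_mul] }

theorem algebraMap_eq (r : R) : algebraMap R (CoHom R A D) r = const r := rfl

/-- Evaluating a polynomial in the algebra `Hom(A, D)` is the operation it induces. -/
theorem aeval_eq_op {n : ℕ} (p : MvPolynomial (Fin n) R) (φ : Fin n → CoHom R A D) :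
    MvPolynomial.aeval φ p = op p φ := by
  induction p using MvPolynomial.induction_on with
  | C r => rw [op_C, MvPolynomial.aeval_C, algebraMap_eq]
  | add p q hp hq => rw [map_add, op_add, hp, hq]
  | mul_X p i hp => rw [map_mul, op_mul, hp, MvPolynomial.aeval_X, op_X]

/-- A map of `R`-algebras is a map that preserves all operations. -/
def _root_.TallWraith.algHomOfOps {D E : Type*} [CommRing D] [Algebra R D] [CommRing E]
    [Algebra R E] (f : D → E)
    (hf : ∀ (n : ℕ) (p : MvPolynomial (Fin n) R) (d : Fin n → D),
      f (MvPolynomial.aeval d p) = MvPolynomial.aeval (fun i => f (d i)) p) : D →ₐ[R] E where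
  toFun := f
  map_one' := by simpa using hf 0 1 Fin.elim0
  map_zero' := by simpa using hf 0 0 Fin.elim0
  map_add' x y := by
    have h := hf 2 (MvPolynomial.X 0 + MvPolynomial.X 1) ![x, y]
    simp only [map_add, MvPolynomial.aeval_X] at h
    exact h
  map_mul' x y := by
    have h := hf 2 (MvPolynomial.X 0 * MvPolynomial.X 1) ![x, y]
    simp only [map_mul, MvPolynomial.aeval_X] at h
    exact h
  commutes' r := by simpa using hf 0 (MvPolynomial.C r) Fin.elim0

theorem map_op {n : ℕ} (f : CoHom R A D →ₐ[R] CoHom R B E) (p : MvPolynomial (Fin n) R)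
    (φ : Fin n → CoHom R A D) : f (op p φ) = op p fun i => f (φ i) := by
  rw [← aeval_eq_op, ← aeval_eq_op, ← AlgHom.comp_apply, MvPolynomial.comp_aeval]

/-- `Hom(A, -)` as a functor: composition with an algebra map `g : D → E`. -/
def map (g : D →ₐ[R] E) : CoHom R A D →ₐ[R] CoHom R A E :=
  algHomOfOps (fun φ => ⟨g.comp φ.hom⟩) fun n p φ => by
    simp only [aeval_eq_op]
    ext1
    simp only [op]
    rw [← AlgHom.comp_assoc, comp_desc]

@[simp] theorem map_hom (g : D →ₐ[R] E) (φ : CoHom R A D) : (map g φ).hom = g.comp φ.hom := rfl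

theorem op_comp {n : ℕ} (g : D →ₐ[R] E) (p : MvPolynomial (Fin n) R) (φ : Fin n → CoHom R A D) :
    g.comp (op p φ).hom = (op p fun i => map g (φ i)).hom :=
  congrArg hom (map_op (map g) p φ)

/-- Composition with a map of co-algebra objects `f : A → B`. -/
def comap (f : A →ₐ[R] B) (hf : IsCoHom f) : CoHom R B D →ₐ[R] CoHom R A D :=
  algHomOfOps (fun φ => ⟨φ.hom.comp f⟩) fun n p φ => by
    simp only [aeval_eq_op]
    ext1
    simp only [op]
    rw [AlgHom.comp_assoc, ← hf n p, ← AlgHom.comp_assoc, comp_desc]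
    congr 2
    funext i
    rw [← AlgHom.comp_assoc, desc_comp_inj]

@[simp] theorem comap_hom (f : A →ₐ[R] B) (hf : IsCoHom f) (φ : CoHom R B D) :
    (comap f hf φ).hom = φ.hom.comp f := rfl

/-- An algebra map is a map of co-algebra objects as soon as composition with it preserves the
operations on maps to all tensor powers of the target. -/
theorem isCoHom_of_op (f : A →ₐ[R] B)
    (h : ∀ (n : ℕ) (p : MvPolynomial (Fin n) R) (φ : Fin n → CoHom R B (Pow R B n)),
      (op p fun i => (⟨(φ i).hom.comp f⟩ : CoHom R A (Pow R B n))).hom = (op p φ).hom.comp f) :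
    IsCoHom f := by
  intro n p
  have := h n p fun i => ⟨inj i⟩
  simp only [op] at this
  rw [this, desc_inj_eq_id, AlgHom.id_comp]

end

end CoHom

theorem isCoHom_id {R A : Type*} [CommRing R] [CommRing A] [Algebra R A] [CoAlg R A] :
    IsCoHom (AlgHom.id R A) := by
  intro n p
  simp only [AlgHom.comp_id]
  rw [desc_inj_eq_id, AlgHom.id_comp]

theorem IsCoHom.comp {R A B C : Type*} [CommRing R] [CommRing A] [Algebra R A] [CoAlg R A]
    [CommRing B] [Algebra R B] [CoAlg R B] [CommRing C] [Algebra R C] [CoAlg R C]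
    {g : B →ₐ[R] C} {f : A →ₐ[R] B} (hg : IsCoHom g) (hf : IsCoHom f) :
    IsCoHom (g.comp f) := by
  refine CoHom.isCoHom_of_op _ fun n p φ => ?_
  have h1 := CoHom.map_op (CoHom.comap f hf (D := Pow R C n)) p
    (fun i => CoHom.comap g hg (φ i))
  rw [← CoHom.map_op (CoHom.comap g hg)] at h1
  exact congrArg CoHom.hom h1.symm

theorem IsCoHom.of_inverse {R A B : Type*} [CommRing R] [CommRing A] [Algebra R A] [CoAlg R A]
    [CommRing B] [Algebra R B] [CoAlg R B] {f : A →ₐ[R] B} (hf : IsCoHom f) (g : B →ₐ[R] A)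
    (hgf : g.comp f = AlgHom.id R A) (hfg : f.comp g = AlgHom.id R B) : IsCoHom g := by
  refine CoHom.isCoHom_of_op _ fun n p φ => ?_
  have h1 := CoHom.map_op (CoHom.comap f hf (D := Pow R A n)) p (fun i => ⟨(φ i).hom.comp g⟩)
  have h2 : (fun i => CoHom.comap f hf (⟨(φ i).hom.comp g⟩ : CoHom R B (Pow R A n))) = φ := by
    funext i; ext1; simp [AlgHom.comp_assoc, hgf]
  rw [h2] at h1
  rw [← h1, CoHom.comap_hom, AlgHom.comp_assoc, hfg, AlgHom.comp_id]


/-! ### The Tall–Wraith product -/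

section Product

/-- The commutative `R`-algebra generated by symbols `a ⊙ b` that are, for fixed `a`,
multiplicative and `R`-linear in `b`. -/
def PreProd (R A B : Type*) [CommRing R] [CommRing B] [Algebra R B] : Type _ :=
  MvPolynomial (A × B) R ⧸ Ideal.span
    ({z | ∃ a b b', z = MvPolynomial.X (a, b + b') - (MvPolynomial.X (a, b) +
          MvPolynomial.X (a, b'))} ∪
     {z | ∃ a b b', z = MvPolynomial.X (a, b * b') - MvPolynomial.X (a, b) *
          MvPolynomial.X (a, b')} ∪
     {z | ∃ a r, z = MvPolynomial.X (a, algebraMap R B r) - MvPolynomial.C r} :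
      Set (MvPolynomial (A × B) R))

namespace PreProd

variable {R A B D : Type*} [CommRing R] [CommRing B] [Algebra R B] [CommRing D] [Algebra R D]

instance : CommRing (PreProd R A B) := inferInstanceAs (CommRing (_ ⧸ _))
instance : Algebra R (PreProd R A B) := inferInstanceAs (Algebra R (_ ⧸ _))

variable (R A B) in
/-- The quotient map. -/
def mk : MvPolynomial (A × B) R →ₐ[R] PreProd R A B := Ideal.Quotient.mkₐ R _

theorem mk_eq {x y : MvPolynomial (A × B) R} (h : x - y ∈
    ({z | ∃ a b b', z = MvPolynomial.X (a, b + b') - (MvPolynomial.X (a, b) +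
          MvPolynomial.X (a, b'))} ∪
     {z | ∃ a b b', z = MvPolynomial.X (a, b * b') - MvPolynomial.X (a, b) *
          MvPolynomial.X (a, b')} ∪
     {z | ∃ a r, z = MvPolynomial.X (a, algebraMap R B r) - MvPolynomial.C r} :
      Set (MvPolynomial (A × B) R))) : mk R A B x = mk R A B y :=
  Ideal.Quotient.eq.mpr (Ideal.subset_span h)

/-- The algebra map `b ↦ a ⊙ b`. -/
def gen (a : A) : B →ₐ[R] PreProd R A B where
  toFun b := mk R A B (MvPolynomial.X (a, b))
  map_one' := by
    have h := mk_eq (R := R) (A := A) (B := B) (x := MvPolynomial.X (a, algebraMap R B 1))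
      (y := MvPolynomial.C 1) (Or.inr ⟨a, 1, rfl⟩)
    simpa using h
  map_zero' := by
    have h := mk_eq (R := R) (A := A) (B := B) (x := MvPolynomial.X (a, algebraMap R B 0))
      (y := MvPolynomial.C 0) (Or.inr ⟨a, 0, rfl⟩)
    simpa using h
  map_add' b b' := by
    rw [← map_add]
    exact mk_eq (Or.inl (Or.inl ⟨a, b, b', rfl⟩))
  map_mul' b b' := by
    rw [← map_mul]
    exact mk_eq (Or.inl (Or.inr ⟨a, b, b', rfl⟩))
  commutes' r := by
    rw [← (mk R A B).commutes r]
    exact mk_eq (Or.inr ⟨a, r, rfl⟩)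

/-- The algebra map with prescribed values on the symbols `a ⊙ b`. -/
def lift (ψ : A → (B →ₐ[R] D)) : PreProd R A B →ₐ[R] D :=
  Ideal.Quotient.liftₐ _ (MvPolynomial.aeval fun x : A × B => ψ x.1 x.2) (by
    intro x hx
    refine (Ideal.span_le (I := RingHom.ker
      (MvPolynomial.aeval (R := R) fun x : A × B => ψ x.1 x.2))).mpr ?_ hx
    rintro z ((⟨a, b, b', rfl⟩ | ⟨a, b, b', rfl⟩) | ⟨a, r, rfl⟩)
    · simp [RingHom.mem_ker]
    · simp [RingHom.mem_ker]
    · simp [RingHom.mem_ker])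

@[simp] theorem lift_gen (ψ : A → (B →ₐ[R] D)) (a : A) (b : B) : lift ψ (gen a b) = ψ a b :=
  (Ideal.Quotient.lift_mk _ _ _).trans (MvPolynomial.aeval_X _ _)

theorem hom_ext {f g : PreProd R A B →ₐ[R] D} (h : ∀ a b, f (gen a b) = g (gen a b)) : f = g := by
  have h' : f.comp (mk R A B) = g.comp (mk R A B) :=
    MvPolynomial.algHom_ext fun x => h x.1 x.2
  ext z
  obtain ⟨x, rfl⟩ := Ideal.Quotient.mk_surjective z
  exact DFunLike.congr_fun h' x

end PreProd

/-- The Tall–Wraith product `A ⊙ B` of an `R`-algebra `A` and a co-algebra object `B`: the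
quotient of `PreProd R A B` that makes `a ↦ (b ↦ a ⊙ b)` compatible with the operations of `A`
and the operations on algebra maps out of `B`, so that
`Hom(A ⊙ B, D) ≅ Hom(A, Hom(B, D))` (see `TW.liftEquiv`). -/
def TW (R A B : Type*) [CommRing R] [CommRing A] [Algebra R A] [CommRing B] [Algebra R B]
    [CoAlg R B] : Type _ :=
  PreProd R A B ⧸ Ideal.span
    {z : PreProd R A B | ∃ (n : ℕ) (p : MvPolynomial (Fin n) R) (a : Fin n → A) (b : B),
      z = PreProd.gen (MvPolynomial.aeval a p) b -
        desc (fun i => PreProd.gen (a i)) (CoAlg.coop p b)}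

namespace TW

variable {R A B C D E : Type*} [CommRing R] [CommRing A] [Algebra R A]
  [CommRing B] [Algebra R B] [CoAlg R B] [CommRing C] [Algebra R C] [CoAlg R C]
  [CommRing D] [Algebra R D] [CommRing E] [Algebra R E]

instance : CommRing (TW R A B) := inferInstanceAs (CommRing (_ ⧸ _))
instance : Algebra R (TW R A B) := inferInstanceAs (Algebra R (_ ⧸ _))

variable (R A B) in
/-- The quotient map. -/
def mk : PreProd R A B →ₐ[R] TW R A B := Ideal.Quotient.mkₐ R _

/-- The universal map `A → Hom(B, A ⊙ B)`. -/
def univ : A →ₐ[R] CoHom R B (TW R A B) :=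
  algHomOfOps (fun a => ⟨(mk R A B).comp (PreProd.gen a)⟩) fun n p a => by
    rw [CoHom.aeval_eq_op]
    ext b
    have h : mk R A B (PreProd.gen (MvPolynomial.aeval a p) b) =
        mk R A B (desc (fun i => PreProd.gen (a i)) (CoAlg.coop p b)) :=
      Ideal.Quotient.eq.mpr (Ideal.subset_span ⟨n, p, a, b, rfl⟩)
    simp only [CoHom.op, AlgHom.comp_apply]
    rw [h, ← AlgHom.comp_apply (mk R A B), comp_desc]

/-- The element `a ⊙ b` of `A ⊙ B`. -/
def gen (a : A) (b : B) : TW R A B := (univ a).hom b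

theorem univ_hom (a : A) (b : B) : ((univ a).hom b : TW R A B) = gen a b := rfl

/-- The algebra map `A ⊙ B → D` that corresponds to `f : A → Hom(B, D)`, i.e.
`a ⊙ b ↦ f a b`. -/
def lift (f : A →ₐ[R] CoHom R B D) : TW R A B →ₐ[R] D :=
  Ideal.Quotient.liftₐ _ (PreProd.lift fun a => (f a).hom) (by
    intro x hx
    refine (Ideal.span_le (I := RingHom.ker (PreProd.lift fun a => (f a).hom))).mpr ?_ hx
    rintro z ⟨n, p, a, b, rfl⟩
    have h1 : f (MvPolynomial.aeval a p) = CoHom.op p fun i => f (a i) := by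
      rw [← CoHom.aeval_eq_op, ← AlgHom.comp_apply, MvPolynomial.comp_aeval]
    have h2 : (PreProd.lift fun a => (f a).hom).comp (desc fun i => PreProd.gen (a i)) =
        desc fun i => (f (a i)).hom := by
      rw [comp_desc]
      congr 1
      funext i
      ext b
      simp
    have h3 := DFunLike.congr_fun h2 (CoAlg.coop p b)
    simp only [AlgHom.comp_apply] at h3
    simp only [SetLike.mem_coe, RingHom.mem_ker, map_sub, PreProd.lift_gen]
    rw [h3, h1, sub_eq_zero]
    rfl)

theorem lift_mk (f : A →ₐ[R] CoHom R B D) (x : PreProd R A B) :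
    lift f (mk R A B x) = PreProd.lift (fun a => (f a).hom) x := rfl

@[simp] theorem lift_gen (f : A →ₐ[R] CoHom R B D) (a : A) (b : B) :
    lift f (gen a b) = (f a).hom b := by
  have h : (gen a b : TW R A B) = mk R A B (PreProd.gen a b) := rfl
  rw [h, lift_mk, PreProd.lift_gen]

theorem hom_ext {f g : TW R A B →ₐ[R] D} (h : ∀ a b, f (gen a b) = g (gen a b)) : f = g := by
  have h' : f.comp (mk R A B) = g.comp (mk R A B) := PreProd.hom_ext h
  ext z
  obtain ⟨x, rfl⟩ := Ideal.Quotient.mk_surjective z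
  exact DFunLike.congr_fun h' x

/-- The map `A → Hom(B, D)` that corresponds to `f : A ⊙ B → D`. -/
def unlift (f : TW R A B →ₐ[R] D) : A →ₐ[R] CoHom R B D := (CoHom.map f).comp univ

@[simp] theorem unlift_hom (f : TW R A B →ₐ[R] D) (a : A) (b : B) :
    (unlift f a).hom b = f (gen a b) := rfl

theorem lift_unlift (f : TW R A B →ₐ[R] D) : lift (unlift f) = f :=
  hom_ext fun a b => by simp

theorem unlift_lift (f : A →ₐ[R] CoHom R B D) : unlift (lift f) = f := by
  ext a b; simp

theorem unlift_injective : Function.Injective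
    (unlift : (TW R A B →ₐ[R] D) → (A →ₐ[R] CoHom R B D)) :=
  Function.LeftInverse.injective lift_unlift

/-- The universal property of `A ⊙ B`. -/
def liftEquiv : (A →ₐ[R] CoHom R B D) ≃ (TW R A B →ₐ[R] D) where
  toFun := lift
  invFun := unlift
  left_inv := unlift_lift
  right_inv := lift_unlift

theorem comp_lift (g : D →ₐ[R] E) (f : A →ₐ[R] CoHom R B D) :
    g.comp (lift f) = lift ((CoHom.map g).comp f) :=
  hom_ext fun a b => by simp

theorem hom_ext_left {f g : TW R (TW R A B) C →ₐ[R] D}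
    (h : ∀ a b c, f (gen (gen a b) c) = g (gen (gen a b) c)) : f = g := by
  apply unlift_injective
  refine hom_ext fun a b => ?_
  ext c
  exact h a b c

section CoAlgebra

variable [CoAlg R A]

/-- The co-operations of `A ⊙ B`: the co-operation belonging to `p` corresponds, under the
universal property, to `p` applied to the coprojections in the algebra `Hom(A, Hom(B, -))`. -/
def coop {n : ℕ} (p : MvPolynomial (Fin n) R) : TW R A B →ₐ[R] Pow R (TW R A B) n :=
  lift (CoHom.op p fun i => ⟨unlift (inj i)⟩).hom

theorem desc_comp_coop {n : ℕ} (p : MvPolynomial (Fin n) R) (φ : Fin n → (TW R A B →ₐ[R] D)) :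
    (desc φ).comp (coop p) = lift (CoHom.op p fun i => ⟨unlift (φ i)⟩).hom := by
  rw [coop, comp_lift, CoHom.op_comp]
  congr 3
  funext i
  ext1
  rw [CoHom.map_hom]
  ext a b
  simp

instance : CoAlg R (TW R A B) where
  coop := coop
  coop_X i := by rw [coop, CoHom.op_X, lift_unlift]
  coop_bind p q := by
    rw [desc_comp_coop, coop, CoHom.op_bind]
    congr 3
    funext i
    ext1
    exact (unlift_lift _).symm

/-- The universal property is compatible with the operations:
`Hom(A ⊙ B, D) ≅ Hom(A, Hom(B, D))` as `R`-algebras. -/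
def liftHom : CoHom R A (CoHom R B D) →ₐ[R] CoHom R (TW R A B) D :=
  algHomOfOps (fun φ => ⟨lift φ.hom⟩) fun n p φ => by
    rw [CoHom.aeval_eq_op, CoHom.aeval_eq_op]
    ext1
    refine Eq.trans ?_ (desc_comp_coop p fun i => lift (φ i).hom).symm
    simp only [unlift_lift]

@[simp] theorem liftHom_hom (φ : CoHom R A (CoHom R B D)) : (liftHom φ).hom = lift φ.hom := rfl

/-- The inverse of `liftHom`. -/
def unliftHom : CoHom R (TW R A B) D →ₐ[R] CoHom R A (CoHom R B D) :=
  algHomOfOps (fun φ => ⟨unlift φ.hom⟩) fun n p φ => by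
    rw [CoHom.aeval_eq_op, CoHom.aeval_eq_op]
    ext1
    apply (liftEquiv (R := R) (A := A) (B := B) (D := D)).injective
    change lift (unlift _) = lift _
    rw [lift_unlift]
    exact desc_comp_coop p fun i => (φ i).hom

@[simp] theorem unliftHom_hom (φ : CoHom R (TW R A B) D) : (unliftHom φ).hom = unlift φ.hom := rfl

end CoAlgebra

theorem hom_ext_right {R A B C D : Type*} [CommRing R] [CommRing A] [Algebra R A] [CoAlg R A]
    [CommRing B] [Algebra R B] [CoAlg R B] [CommRing C] [Algebra R C] [CommRing D] [Algebra R D]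
    {f g : TW R C (TW R A B) →ₐ[R] D}
    (h : ∀ c a b, f (gen c (gen a b)) = g (gen c (gen a b))) : f = g := by
  apply unlift_injective
  ext1 c
  ext1
  exact hom_ext fun a b => h c a b

end TW

end Product

/-! ### Unit object, functoriality and coherence maps -/

section Coherence

set_option linter.unusedSectionVars false

open Polynomial

theorem CoHom.isCoHom_of_algHom {R A B : Type*} [CommRing R] [CommRing A] [Algebra R A]
    [CoAlg R A] [CommRing B] [Algebra R B] [CoAlg R B] (f : A →ₐ[R] B)
    (F : ∀ n : ℕ, CoHom R B (Pow R B n) →ₐ[R] CoHom R A (Pow R B n))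
    (hF : ∀ (n : ℕ) (φ : CoHom R B (Pow R B n)), (F n φ).hom = φ.hom.comp f) : IsCoHom f := by
  refine CoHom.isCoHom_of_op _ fun n p φ => ?_
  rw [← hF, CoHom.map_op]
  congr 2
  funext i
  ext1
  exact (hF n (φ i)).symm

/-- The free `R`-algebra `R[X]` on one generator represents the identity functor; its
co-operation belonging to `p` sends `X` to `p(X₁, …, Xₙ)`. -/
instance unitCoAlg {R : Type*} [CommRing R] : CoAlg R R[X] where
  coop p := Polynomial.aeval (MvPolynomial.aeval (fun i => inj i (X : R[X])) p)
  coop_X i := by ext; simp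
  coop_bind p q := by
    ext
    simp only [Polynomial.aeval_X, AlgHom.comp_apply]
    rw [MvPolynomial.aeval_bind₁, ← AlgHom.comp_apply (desc _), MvPolynomial.comp_aeval]
    simp

variable {R A A' B B' C D : Type*} [CommRing R] [CommRing A] [Algebra R A] [CoAlg R A]
  [CommRing A'] [Algebra R A'] [CoAlg R A'] [CommRing B'] [Algebra R B'] [CoAlg R B']
  [CommRing B] [Algebra R B] [CoAlg R B] [CommRing C] [Algebra R C] [CoAlg R C]
  [CommRing D] [Algebra R D]

namespace TW

/-- `Hom(R[X], D) → D`, evaluation at the generator. -/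
def evalGen : CoHom R R[X] D →ₐ[R] D :=
  algHomOfOps (fun φ => φ.hom X) fun n p φ => by
    rw [CoHom.aeval_eq_op]
    simp only [CoHom.op, CoAlg.coop, AlgHom.comp_apply, Polynomial.aeval_X]
    rw [← AlgHom.comp_apply (desc _), MvPolynomial.comp_aeval]
    simp

@[simp] theorem evalGen_apply (φ : CoHom R R[X] D) : evalGen φ = φ.hom X := rfl

/-- `D → Hom(R[X], D)`, the inverse of `evalGen`. -/
def ofGen : D →ₐ[R] CoHom R R[X] D :=
  algHomOfOps (fun d => ⟨Polynomial.aeval d⟩) fun n p d => by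
    rw [CoHom.aeval_eq_op]
    ext
    simp only [CoHom.op, CoAlg.coop, AlgHom.comp_apply, Polynomial.aeval_X]
    rw [← AlgHom.comp_apply (desc _), MvPolynomial.comp_aeval]
    simp

@[simp] theorem ofGen_hom (d : D) : (ofGen (R := R) d).hom = Polynomial.aeval d := rfl

/-- `f ⊙ g`, given by `a ⊙ b ↦ f a ⊙ g b`. -/
def tensor (f : A →ₐ[R] A') (g : B →ₐ[R] B') (hg : IsCoHom g) : TW R A B →ₐ[R] TW R A' B' :=
  lift (((CoHom.comap g hg).comp univ).comp f)

@[simp] theorem tensor_gen (f : A →ₐ[R] A') (g : B →ₐ[R] B') (hg : IsCoHom g) (a : A) (b : B) :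
    tensor f g hg (gen a b) = gen (f a) (g b) :=
  lift_gen _ _ _

theorem tensor_isCoHom (f : A →ₐ[R] A') (hf : IsCoHom f) (g : B →ₐ[R] B') (hg : IsCoHom g) :
    IsCoHom (tensor f g hg) :=
  CoHom.isCoHom_of_algHom _
    (fun _ => ((liftHom.comp (CoHom.comap f hf)).comp (CoHom.map (CoHom.comap g hg))).comp
      unliftHom)
    fun n φ => hom_ext fun a b => by simp

variable (R A B C) in
/-- The associativity map `(a ⊙ b) ⊙ c ↦ a ⊙ (b ⊙ c)`. -/
def assoc : TW R (TW R A B) C →ₐ[R] TW R A (TW R B C) :=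
  lift (lift (unliftHom.comp univ))

@[simp] theorem assoc_gen (a : A) (b : B) (c : C) :
    assoc R A B C (gen (gen a b) c) = gen a (gen b c) := by
  simp [assoc, univ_hom]

variable (R A B C) in
/-- The inverse associativity map `a ⊙ (b ⊙ c) ↦ (a ⊙ b) ⊙ c`. -/
def assocInv : TW R A (TW R B C) →ₐ[R] TW R (TW R A B) C :=
  lift (liftHom.comp ((CoHom.map univ).comp univ))

@[simp] theorem assocInv_gen (a : A) (b : B) (c : C) :
    assocInv R A B C (gen a (gen b c)) = gen (gen a b) c := by
  simp [assocInv, univ_hom]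

theorem assoc_isCoHom : IsCoHom (assoc R A B C) :=
  CoHom.isCoHom_of_algHom _
    (fun _ => ((liftHom.comp liftHom).comp (CoHom.map unliftHom)).comp unliftHom)
    fun n φ => hom_ext_left fun a b c => by simp

theorem assoc_comp_inv : (assoc R A B C).comp (assocInv R A B C) = AlgHom.id R _ :=
  hom_ext_right fun a b c => by simp

theorem inv_comp_assoc : (assocInv R A B C).comp (assoc R A B C) = AlgHom.id R _ :=
  hom_ext_left fun a b c => by simp

variable (R A) in
/-- The left unit map `X ⊙ a ↦ a`. -/
def lunit : TW R R[X] A →ₐ[R] A := lift (Polynomial.aeval ⟨AlgHom.id R A⟩)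

@[simp] theorem lunit_gen (a : A) : lunit R A (gen X a) = a := by simp [lunit]

theorem hom_ext_lunit {f g : TW R R[X] A →ₐ[R] D} (h : ∀ a, f (gen X a) = g (gen X a)) :
    f = g := by
  apply unlift_injective
  refine Polynomial.algHom_ext ?_
  ext a
  exact h a

theorem hom_ext_runit {f g : TW R A R[X] →ₐ[R] D} (h : ∀ a, f (gen a X) = g (gen a X)) :
    f = g := by
  apply unlift_injective
  ext1 a
  ext1
  refine Polynomial.algHom_ext ?_
  exact h a

variable (R A) in
/-- The inverse left unit map `a ↦ X ⊙ a`. -/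
def lunitInv : A →ₐ[R] TW R R[X] A := (univ (X : R[X])).hom

@[simp] theorem lunitInv_apply (a : A) : lunitInv R A a = gen X a := rfl

theorem lunit_isCoHom : IsCoHom (lunit R A) :=
  CoHom.isCoHom_of_algHom _ (fun _ => liftHom.comp ofGen)
    fun n φ => hom_ext_lunit fun a => by simp

theorem lunit_comp_inv : (lunit R A).comp (lunitInv R A) = AlgHom.id R _ := by
  ext a; simp

theorem inv_comp_lunit : (lunitInv R A).comp (lunit R A) = AlgHom.id R _ :=
  hom_ext_lunit fun a => by simp

variable (R A) in
/-- The right unit map `a ⊙ X ↦ a`. -/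
def runit : TW R A R[X] →ₐ[R] A := lift ofGen

@[simp] theorem runit_gen (a : A) : runit R A (gen a X) = a := by simp [runit]

variable (R A) in
/-- The inverse right unit map `a ↦ a ⊙ X`. -/
def runitInv : A →ₐ[R] TW R A R[X] := evalGen.comp univ

@[simp] theorem runitInv_apply (a : A) : runitInv R A a = gen a X := rfl

theorem runit_isCoHom : IsCoHom (runit R A) :=
  CoHom.isCoHom_of_algHom _ (fun _ => liftHom.comp (CoHom.map ofGen))
    fun n φ => hom_ext_runit fun a => by simp

theorem runit_comp_inv : (runit R A).comp (runitInv R A) = AlgHom.id R _ := by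
  ext a; simp

theorem inv_comp_runit : (runitInv R A).comp (runit R A) = AlgHom.id R _ :=
  hom_ext_runit fun a => by simp

end TW

end Coherence

/-! ### The monoidal category of co-algebra objects -/

/-- The category of co-(commutative `R`-algebra) objects in commutative `R`-algebras. -/
structure CoAlgCat (R : Type u) [CommRing R] where
  /-- the underlying type -/
  carrier : Type u
  [commRing : CommRing carrier]
  [algebra : Algebra R carrier]
  [coAlg : CoAlg R carrier]

namespace CoAlgCat

variable {R : Type u} [CommRing R]

attribute [instance] CoAlgCat.commRing CoAlgCat.algebra CoAlgCat.coAlg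

instance : CoeSort (CoAlgCat R) (Type u) := ⟨carrier⟩

variable (R) in
/-- Bundle a co-algebra object. -/
abbrev of (A : Type u) [CommRing A] [Algebra R A] [CoAlg R A] : CoAlgCat R := ⟨A⟩

/-- Morphisms are algebra maps that commute with all co-operations. -/
@[ext] structure Hom (A B : CoAlgCat R) where
  /-- the underlying algebra map -/
  hom : A →ₐ[R] B
  isCoHom : IsCoHom hom

instance : Category (CoAlgCat R) where
  Hom := Hom
  id A := ⟨AlgHom.id R A, isCoHom_id⟩
  comp f g := ⟨g.hom.comp f.hom, g.isCoHom.comp f.isCoHom⟩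

@[ext] theorem hom_ext {A B : CoAlgCat R} {f g : A ⟶ B} (h : f.hom = g.hom) : f = g :=
  Hom.ext h

@[simp] theorem id_hom (A : CoAlgCat R) : Hom.hom (𝟙 A) = AlgHom.id R A := rfl
@[simp] theorem comp_hom {A B C : CoAlgCat R} (f : A ⟶ B) (g : B ⟶ C) :
    (f ≫ g).hom = g.hom.comp f.hom := rfl

/-- An isomorphism from a morphism and an inverse algebra map. -/
def isoMk {A B : CoAlgCat R} (f : A →ₐ[R] B) (hf : IsCoHom f) (g : B →ₐ[R] A)
    (hgf : g.comp f = AlgHom.id R A) (hfg : f.comp g = AlgHom.id R B) : A ≅ B where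
  hom := ⟨f, hf⟩
  inv := ⟨g, hf.of_inverse g hgf hfg⟩
  hom_inv_id := hom_ext hgf
  inv_hom_id := hom_ext hfg

instance : MonoidalCategoryStruct (CoAlgCat R) where
  tensorObj A B := of R (TW R A B)
  tensorHom f g := ⟨TW.tensor f.hom g.hom g.isCoHom,
    TW.tensor_isCoHom f.hom f.isCoHom g.hom g.isCoHom⟩
  whiskerLeft A _ _ g := ⟨TW.tensor (AlgHom.id R A) g.hom g.isCoHom,
    TW.tensor_isCoHom _ isCoHom_id g.hom g.isCoHom⟩
  whiskerRight f B := ⟨TW.tensor f.hom (AlgHom.id R B) isCoHom_id,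
    TW.tensor_isCoHom f.hom f.isCoHom _ isCoHom_id⟩
  tensorUnit := of R (Polynomial R)
  associator A B C := isoMk (TW.assoc R A B C) TW.assoc_isCoHom (TW.assocInv R A B C)
    TW.inv_comp_assoc TW.assoc_comp_inv
  leftUnitor A := isoMk (TW.lunit R A) TW.lunit_isCoHom (TW.lunitInv R A)
    TW.inv_comp_lunit TW.lunit_comp_inv
  rightUnitor A := isoMk (TW.runit R A) TW.runit_isCoHom (TW.runitInv R A)
    TW.inv_comp_runit TW.runit_comp_inv

theorem tensor_hom_ext {A B C : CoAlgCat R} {f g : A ⊗ B ⟶ C}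
    (h : ∀ (a : A) (b : B), f.hom (TW.gen a b) = g.hom (TW.gen a b)) : f = g :=
  hom_ext (TW.hom_ext h)

theorem tensorHom_gen {A A' B B' : CoAlgCat R} (f : A ⟶ A') (g : B ⟶ B') (a : A) (b : B) :
    (f ⊗ₘ g).hom (TW.gen a b) = TW.gen (f.hom a) (g.hom b) := TW.tensor_gen _ _ _ _ _

theorem whiskerLeft_gen {A B B' : CoAlgCat R} (g : B ⟶ B') (a : A) (b : B) :
    (A ◁ g).hom (TW.gen a b) = TW.gen a (g.hom b) := TW.tensor_gen _ _ _ _ _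

theorem whiskerRight_gen {A A' B : CoAlgCat R} (f : A ⟶ A') (a : A) (b : B) :
    (f ▷ B).hom (TW.gen a b) = TW.gen (f.hom a) b := TW.tensor_gen _ _ _ _ _

theorem associator_gen {A B C : CoAlgCat R} (a : A) (b : B) (c : C) :
    (α_ A B C).hom.hom (TW.gen (TW.gen a b) c) = TW.gen a (TW.gen b c) := TW.assoc_gen _ _ _

theorem leftUnitor_gen {A : CoAlgCat R} (a : A) :
    (λ_ A).hom.hom (TW.gen Polynomial.X a) = a := TW.lunit_gen _

theorem rightUnitor_gen {A : CoAlgCat R} (a : A) :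
    (ρ_ A).hom.hom (TW.gen a Polynomial.X) = a := TW.runit_gen _

instance : MonoidalCategory (CoAlgCat R) where
  tensorHom_def f g := tensor_hom_ext fun a b => by
    simp only [comp_hom, AlgHom.comp_apply, tensorHom_gen, whiskerRight_gen, whiskerLeft_gen]
  id_tensorHom_id A B := tensor_hom_ext fun a b => tensorHom_gen _ _ _ _
  tensorHom_comp_tensorHom f₁ f₂ g₁ g₂ := tensor_hom_ext fun a b => by
    simp only [comp_hom, AlgHom.comp_apply, tensorHom_gen]
  whiskerLeft_id A B := tensor_hom_ext fun a b => whiskerLeft_gen _ _ _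
  id_whiskerRight A B := tensor_hom_ext fun a b => whiskerRight_gen _ _ _
  associator_naturality {A B C A' B' C'} f g h := hom_ext (TW.hom_ext_left fun a b c => by
    change TW.assoc R A' B' C' (TW.tensor (TW.tensor f.hom g.hom g.isCoHom) h.hom h.isCoHom
        (TW.gen (TW.gen a b) c)) =
      TW.tensor f.hom (TW.tensor g.hom h.hom h.isCoHom)
        (TW.tensor_isCoHom g.hom g.isCoHom h.hom h.isCoHom)
        (TW.assoc R A B C (TW.gen (TW.gen a b) c))
    simp)
  leftUnitor_naturality {A B} f := hom_ext (TW.hom_ext_lunit fun a => by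
    change TW.lunit R B (TW.tensor (AlgHom.id R (Polynomial R)) f.hom f.isCoHom
      (TW.gen Polynomial.X a)) = f.hom (TW.lunit R A (TW.gen Polynomial.X a))
    simp)
  rightUnitor_naturality {A B} f := hom_ext (TW.hom_ext_runit fun a => by
    change TW.runit R B (TW.tensor f.hom (AlgHom.id R (Polynomial R)) isCoHom_id
      (TW.gen a Polynomial.X)) = f.hom (TW.runit R A (TW.gen a Polynomial.X))
    simp)
  pentagon A B C D := by
    refine hom_ext (TW.unlift_injective (TW.hom_ext_left fun a b c => ?_))
    ext d
    change TW.tensor (AlgHom.id R A) (TW.assoc R B C D) TW.assoc_isCoHom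
        (TW.assoc R A (TW R B C) D (TW.tensor (TW.assoc R A B C) (AlgHom.id R D) isCoHom_id
          (TW.gen (TW.gen (TW.gen a b) c) d))) =
      TW.assoc R A B (TW R C D) (TW.assoc R (TW R A B) C D (TW.gen (TW.gen (TW.gen a b) c) d))
    simp
  triangle A B := by
    refine hom_ext (TW.unlift_injective (TW.hom_ext_runit fun a => ?_))
    ext b
    change TW.tensor (AlgHom.id R A) (TW.lunit R B) TW.lunit_isCoHom
        (TW.assoc R A (Polynomial R) B (TW.gen (TW.gen a Polynomial.X) b)) =
      TW.tensor (TW.runit R A) (AlgHom.id R B) isCoHom_id (TW.gen (TW.gen a Polynomial.X) b)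
    simp

end CoAlgCat

/-! ### Modules over a Tall–Wraith monoid -/

section Modules

variable {R : Type u} [CommRing R]

/-- A module structure over a Tall–Wraith monoid `T` (a monoid in `CoAlgCat R`) on a commutative
`R`-algebra `B`: an `R`-algebra map `B → Hom(T, B)`, thought of as the action
`(t, b) ↦ t · b` of the elements of `T` on `B`, compatible with the unit and the multiplication
of `T` through `Hom(R[X], B) ≅ B` and `Hom(T ⊙ T, B) ≅ Hom(T, Hom(T, B))`. -/
structure TWAction (T : CoAlgCat R) [MonObj T] (B : Type u) [CommRing B] [Algebra R B] where
  /-- the map `b ↦ (t ↦ t · b)` -/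
  act : B →ₐ[R] CoHom R T B
  one_act : ∀ b : B, (act b).hom ((η[T] : 𝟙_ (CoAlgCat R) ⟶ T).hom Polynomial.X) = b
  mul_act : ∀ (b : B) (t t' : T),
    (act b).hom ((μ[T] : T ⊗ T ⟶ T).hom (TW.gen t t')) = (act ((act b).hom t)).hom t'

/-- The category of commutative `R`-algebras that are modules over the Tall–Wraith monoid `T`. -/
structure TWMod (T : CoAlgCat R) [MonObj T] where
  /-- the underlying algebra -/
  alg : CommAlgCat.{u} R
  /-- the action of `T` -/
  action : TWAction T alg

namespace TWMod

variable {T : CoAlgCat R} [MonObj T]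

/-- Morphisms are algebra maps that commute with the action. -/
@[ext] structure Hom (M N : TWMod T) where
  /-- the underlying map of algebras -/
  hom : M.alg ⟶ N.alg
  map_act : ∀ (b : M.alg) (t : T),
    hom.hom ((M.action.act b).hom t) = (N.action.act (hom.hom b)).hom t

instance : Category (TWMod T) where
  Hom := Hom
  id M := ⟨𝟙 M.alg, fun _ _ => rfl⟩
  comp f g := ⟨f.hom ≫ g.hom, fun b t => by simp [f.map_act, g.map_act]⟩

variable (T) in
/-- The forgetful functor to commutative `R`-algebras. -/
def forget : TWMod T ⥤ CommAlgCat.{u} R where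
  obj M := M.alg
  map f := f.hom

end TWMod

end Modules

/-! ### Algebras of functions -/

section Functions

/-- The algebra map `R^S → R^{S'}` given by composition with `f : S' → S`. -/
def pullback (R : Type*) [CommRing R] {S S' : Type*} (f : S' → S) : (S → R) →ₐ[R] (S' → R) where
  toFun h := fun s => h (f s)
  map_one' := rfl
  map_mul' _ _ := rfl
  map_zero' := rfl
  map_add' _ _ := rfl
  commutes' _ := rfl

@[simp] theorem pullback_apply (R : Type*) [CommRing R] {S S' : Type*} (f : S' → S) (h : S → R)
    (s : S') : pullback R f h s = h (f s) := rfl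

/-- The contravariant functor `S ↦ R^S` from sets to commutative `R`-algebras. -/
def con (R : Type u) [CommRing R] : (Type u)ᵒᵖ ⥤ CommAlgCat.{u} R where
  obj S := CommAlgCat.of R (S.unop → R)
  map f := CommAlgCat.ofHom (pullback R fun s => f.unop s)

/-- The map `R^R ⊗ ⋯ ⊗ R^R → R^{Rⁿ}` out of the coproduct whose `i`-th component is composition
with the `i`-th projection `Rⁿ → R`. -/
def kunneth (R : Type*) [CommRing R] (n : ℕ) : Pow R (R → R) n →ₐ[R] ((Fin n → R) → R) :=
  desc fun i => pullback R fun x => x i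

end Functions

end

end TallWraith

namespace TallWraith

noncomputable section

/-! ### The Künneth isomorphism -/

section Kunneth

variable {R : Type*} [CommRing R]

/-! Since `R` is finite, `R^R` is free over `R` on the indicator functions of points. Tensors of
indicators form a basis of the `n`-fold tensor power, and `κ_n` sends them to the indicators of the
points of `Rⁿ`. Thus `κ_n` is the coordinate map of a finite basis, hence bijective
(`kunneth_bijective`).

Consequently `S ↦ R^S` turns the powers `Rⁿ` into coproducts, and so turns the `R`-algebra `R` into
a co-algebra object: `Δ_p` is the pullback along the polynomial function `p : Rⁿ → R`, carried back
through `κ_n`. Equations between maps into a tensor power may be tested after the injective `κ_n`,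
where they become equations between functions on `Rⁿ`.

The lemma carrying the rest is `op_pullback`: sending `h : S → R` to the pullback along `h` turns
pointwise operations on `R^S` into the operations of `Hom(R^R, R^S)`. Hence composition is an
algebra map `R^S → Hom(R^R, R^S)`, which is the action; for `S = R` the universal property of `⊙`
turns it into the multiplication. Maps out of `⊙` are determined on generators, so the monoid and
module laws reduce to the unit and associativity laws of composition. What remains is that unit and
multiplication respect the co-operations (`functionOne_isCoHom`, `functionMul_isCoHom`). -/

theorem kunneth_tprod (n : ℕ) (f : Fin n → R → R) (x : Fin n → R) :
    kunneth R n (PiTensorProduct.tprod R f) x = ∏ i, f i (x i) := by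
  simp [kunneth, desc_tprod, Finset.prod_apply]

/-- The values of `kunneth R n z` are the coordinates of `z` in the basis of the tensor power
formed by the tensors of indicator functions. -/
theorem kunneth_apply_eq_repr [Finite R] (n : ℕ) (z : Pow R (R → R) n) (x : Fin n → R) :
    kunneth R n z x = (Basis.piTensorProduct fun _ : Fin n => Pi.basisFun R R).repr z x := by
  -- Both sides are linear in `z`; on a pure tensor of functions `f i` both equal `∏ i, f i (x i)`.
  induction z using PiTensorProduct.induction_on with
  | smul_tprod r f => simp [kunneth_tprod]
  | add y z hy hz => simp [hy, hz]

theorem kunneth_bijective [Finite R] (n : ℕ) : Function.Bijective (kunneth R n) := by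
  let b := Basis.piTensorProduct fun _ : Fin n => Pi.basisFun R R
  have h : ⇑(kunneth R n) = b.equivFun := by
    funext z x
    exact kunneth_apply_eq_repr n z x
  rw [h]
  exact b.equivFun.bijective

variable (R) in
/-- The isomorphism between the tensor power of `R^R` and `R^{Rⁿ}`. -/
def kunnethEquiv [Finite R] (n : ℕ) : Pow R (R → R) n ≃ₐ[R] ((Fin n → R) → R) :=
  AlgEquiv.ofBijective (kunneth R n) (kunneth_bijective n)

/-- A family of pullbacks along `x i : S → R` factors through the pullback along
`S → Rⁿ`. -/
theorem desc_pullback {S : Type*} {n : ℕ} (x : Fin n → S → R) :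
    (desc fun i => pullback R (x i)) =
      (pullback R fun s i => x i s).comp (kunneth R n) := by
  rw [kunneth, comp_desc]
  rfl

theorem desc_pullback_apply {S : Type*} {n : ℕ} (x : Fin n → S → R) (z : Pow R (R → R) n) (s : S) :
    desc (fun i => pullback R (x i)) z s = kunneth R n z fun i => x i s := by
  rw [desc_pullback]
  rfl

theorem kunneth_inj {n : ℕ} (i : Fin n) (f : R → R) :
    kunneth R n (inj i f) = fun x => f (x i) :=
  desc_inj _ i f

end Kunneth

/-! ### Functions as a co-algebra object -/

section Functions

variable {R : Type*} [CommRing R]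

/-- Links the operations of the algebra `R^S`, which `algHomOfOps` expresses by `aeval`, to the
polynomial functions `eval x p` that define the co-operations. -/
theorem aeval_function_apply {S : Type*} {n : ℕ} (p : MvPolynomial (Fin n) R)
    (h : Fin n → S → R) (s : S) :
    MvPolynomial.aeval h p s = MvPolynomial.eval (fun i => h i s) p := by
  induction p using MvPolynomial.induction_on with
  | C r => simp
  | add p q hp hq => simp [hp, hq]
  | mul_X p i hp => simp [hp]

variable (R) in
/-- The unit `R[X] → R^R`, `X ↦ id`. -/
def functionOne : Polynomial R →ₐ[R] (R → R) := Polynomial.aeval id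

theorem functionOne_X : functionOne R Polynomial.X = id := Polynomial.aeval_X id

variable [Finite R]

/-- The co-operation of `R^R` belonging to `p` is composition with `p`, seen as a function
`Rⁿ → R`. -/
def functionCoop {n : ℕ} (p : MvPolynomial (Fin n) R) : (R → R) →ₐ[R] Pow R (R → R) n :=
  (kunnethEquiv R n).symm.toAlgHom.comp (pullback R fun x => MvPolynomial.eval x p)

theorem kunneth_functionCoop {n : ℕ} (p : MvPolynomial (Fin n) R) (f : R → R) :
    kunneth R n (functionCoop p f) = fun x => f (MvPolynomial.eval x p) :=
  (kunnethEquiv R n).apply_symm_apply _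

/-- After `κ_m`, the component `Δ_{q i}` becomes the pullback along the polynomial function `q i`,
and a family of pullbacks factors through `κ_n`. This is the substitution rule for co-operations,
read on functions. -/
theorem kunneth_desc_functionCoop {m n : ℕ} (q : Fin n → MvPolynomial (Fin m) R)
    (z : Pow R (R → R) n) :
    kunneth R m (desc (fun i => functionCoop (q i)) z) =
      fun x => kunneth R n z fun i => MvPolynomial.eval x (q i) := by
  have h : (kunneth R m).comp (desc fun i => functionCoop (q i)) =
      desc fun i => pullback R fun x => MvPolynomial.eval x (q i) := by
    rw [comp_desc]
    congr 1
    funext i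
    exact AlgHom.ext (kunneth_functionCoop (q i))
  funext x
  rw [← AlgHom.comp_apply, h, desc_pullback_apply]

/-- By injectivity of `κ`, both axioms are statements about functions: a variable evaluates to a
coordinate, and evaluating a substituted polynomial at `x` is evaluating `p` at the values of the `q
i` at `x`. -/
instance functionCoAlg : CoAlg R (R → R) where
  coop := functionCoop
  coop_X i := AlgHom.ext fun f => (kunneth_bijective _).injective <| by
    rw [kunneth_functionCoop, kunneth_inj]
    simp
  coop_bind p q := AlgHom.ext fun f => (kunneth_bijective _).injective <| by
    rw [AlgHom.comp_apply, kunneth_desc_functionCoop, kunneth_functionCoop, kunneth_functionCoop]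
    funext x
    rw [← MvPolynomial.coe_aeval_eq_eval, RingHom.coe_coe, MvPolynomial.aeval_bind₁]
    rfl

theorem kunneth_coop {n : ℕ} (p : MvPolynomial (Fin n) R) (f : R → R) :
    kunneth R n (CoAlg.coop p f) = fun x => f (MvPolynomial.eval x p) :=
  kunneth_functionCoop p f

/-- The operations on the algebra maps `R^R → R^S` given by composition with functions
`S → R` are the pointwise operations on these functions. -/
theorem op_pullback {S : Type*} {n : ℕ} (p : MvPolynomial (Fin n) R) (h : Fin n → S → R) :
    CoHom.op p (fun i => (⟨pullback R (h i)⟩ : CoHom R (R → R) (S → R))) =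
      ⟨pullback R fun s => MvPolynomial.eval (fun i => h i s) p⟩ := by
  ext g s
  -- At `g` and `s` the left side is `κ_n (Δ_p g)` at the point `(h i s)_i`, that is, `g` of the
  -- value of `p` there.
  simp only [CoHom.op, AlgHom.comp_apply, desc_pullback_apply, kunneth_coop, pullback_apply]

variable (R) in
/-- The action of `R^R` on `R^S` by composition, as an algebra map `R^S → Hom(R^R, R^S)`. -/
def functionAct (S : Type*) : (S → R) →ₐ[R] CoHom R (R → R) (S → R) :=
  algHomOfOps (fun h => ⟨pullback R h⟩) fun n p h => by
    rw [CoHom.aeval_eq_op, op_pullback]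
    congr 2
    funext s
    exact aeval_function_apply p h s

variable (R) in
/-- The multiplication `f ⊙ g ↦ g ∘ f`. -/
def functionMul : TW R (R → R) (R → R) →ₐ[R] (R → R) := TW.lift (functionAct R R)

theorem functionMul_gen (f g : R → R) : functionMul R (TW.gen f g) = g ∘ f :=
  TW.lift_gen _ f g

/-- After `κ_n`, both sides send `f ⊙ g` to `x ↦ g (f (p x))`. For the side starting with the
co-operation of `R^R ⊙ R^R`, that co-operation is by construction an operation in `Hom(R^R, Hom(R^R,
-))`, which `op_pullback` can compute. -/
theorem functionMul_isCoHom : IsCoHom (functionMul R) := by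
  intro n p
  refine TW.hom_ext fun f g => (kunneth_bijective n).injective ?_
  -- The `i`-th component sends `f ⊙ g` to `x ↦ g (f (x i))`, the action of `g` on `f` composed with
  -- the `i`-th projection.
  have h₁ : (kunneth R n).comp (desc fun i => (inj i).comp (functionMul R)) =
      desc fun i => TW.lift ((functionAct R (Fin n → R)).comp (pullback R fun x => x i)) := by
    rw [comp_desc]
    congr 1
    funext i
    refine TW.hom_ext fun f g => ?_
    simp only [AlgHom.comp_apply, functionMul_gen, kunneth_inj, TW.lift_gen]
    rfl
  have h₂ : ((kunneth R n).comp (desc fun i => (inj i).comp (functionMul R))).comp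
      (CoAlg.coop p) = TW.lift ((functionAct R (Fin n → R)).comp
        (pullback R fun x => MvPolynomial.eval x p)) := by
    rw [h₁]
    refine (TW.desc_comp_coop p _).trans ?_
    simp only [TW.unlift_lift]
    congr 1
    -- `functionAct` is an algebra map, so composing with it commutes with the operation of `p`.
    -- This leaves `p` applied to the pullbacks along the projections, which is the pullback along
    -- `p`.
    refine (CoHom.op_comp (functionAct R (Fin n → R)) p
      fun i => (⟨pullback R fun x => x i⟩ : CoHom R (R → R) ((Fin n → R) → R))).symm.trans ?_
    rw [op_pullback]
  refine (DFunLike.congr_fun h₂ (TW.gen f g)).trans ?_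
  rw [AlgHom.comp_apply, functionMul_gen, kunneth_coop, TW.lift_gen]
  rfl

/-- It suffices to compare values at `X`. There `κ_n` turns the coprojections of `id` into the
coordinate functions, so both sides become `x ↦ p x`. -/
theorem functionOne_isCoHom : IsCoHom (functionOne R) := by
  intro n p
  refine Polynomial.algHom_ext ((kunneth_bijective n).injective ?_)
  rw [AlgHom.comp_apply, AlgHom.comp_apply, functionOne_X, kunneth_coop]
  simp only [CoAlg.coop, Polynomial.aeval_X]
  rw [← AlgHom.comp_apply, ← AlgHom.comp_apply, MvPolynomial.comp_aeval]
  funext x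
  rw [aeval_function_apply]
  simp [functionOne_X, kunneth_inj]

end Functions

/-! ### The Tall–Wraith monoid of functions and its modules -/

section Monoid

variable (R : Type u) [CommRing R] [Finite R]

/-- On the generators `X ⊙ f`, `f ⊙ X` and `(f ⊙ g) ⊙ h` the laws read `f ∘ id = f`, `id ∘ f = f`
and associativity of `∘`. Each `change` unbundles the categorical composites into algebra maps. -/
instance functionMonObj : MonObj (CoAlgCat.of R (R → R)) where
  one := ⟨functionOne R, functionOne_isCoHom⟩
  mul := ⟨functionMul R, functionMul_isCoHom⟩
  one_mul := CoAlgCat.hom_ext <| TW.hom_ext_lunit fun f => by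
    change functionMul R (TW.tensor _ _ _ (TW.gen Polynomial.X f)) =
      TW.lunit R (R → R) (TW.gen Polynomial.X f)
    rw [TW.tensor_gen, functionMul_gen, functionOne_X, TW.lunit_gen]
    rfl
  mul_one := CoAlgCat.hom_ext <| TW.hom_ext_runit fun f => by
    change functionMul R (TW.tensor _ _ _ (TW.gen f Polynomial.X)) =
      TW.runit R (R → R) (TW.gen f Polynomial.X)
    rw [TW.tensor_gen, functionMul_gen, functionOne_X, TW.runit_gen]
    rfl
  mul_assoc := CoAlgCat.hom_ext <| TW.hom_ext_left fun f g h => by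
    change functionMul R (TW.tensor _ _ _ (TW.gen (TW.gen f g) h)) =
      functionMul R (TW.tensor _ _ _ (TW.assoc R _ _ _ (TW.gen (TW.gen f g) h)))
    simp only [TW.assoc_gen, TW.tensor_gen, functionMul_gen]
    rfl

/-- Composition makes `R^S` a module over `R^R`. -/
def functionAction (S : (Type u)ᵒᵖ) :
    TWAction (CoAlgCat.of R (R → R)) ((con R).obj S) where
  act := functionAct R S.unop
  one_act b := by
    change pullback R b (functionOne R Polynomial.X) = b
    rw [functionOne_X]
    rfl
  -- The reversed order in `f ⊙ g ↦ g ∘ f` matches the module law: `(g ∘ f) ∘ b = g ∘ (f ∘ b)`.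
  mul_act b f g := by
    change pullback R b (functionMul R (TW.gen f g)) = _
    rw [functionMul_gen]
    rfl

/-- The lift of `S ↦ R^S` to modules over `R^R`. -/
def conMod : (Type u)ᵒᵖ ⥤ TWMod (CoAlgCat.of R (R → R)) where
  obj S := ⟨(con R).obj S, functionAction R S⟩
  -- The action composes on the left and the functor on the right, so they commute by associativity
  -- of `∘`, which is definitional.
  map f := ⟨(con R).map f, fun _ _ => rfl⟩

end Monoid

end

end TallWraith

theorem mainTheorem10 (R : Type u) [CommRing R] [Finite R] :
    (∀ n : ℕ, Function.Bijective (TallWraith.kunneth R n)) ∧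
    ∃ c : TallWraith.CoAlg R (R → R),
      (∀ (n : ℕ) (p : MvPolynomial (Fin n) R) (f : R → R),
        TallWraith.kunneth R n (TallWraith.CoAlg.coop p f) =
          fun x => f (MvPolynomial.eval x p)) ∧
      ∃ m : MonObj (TallWraith.CoAlgCat.of R (R → R)),
        (η[TallWraith.CoAlgCat.of R (R → R)]).hom Polynomial.X = id ∧
        (∀ f g : R → R,
          (μ[TallWraith.CoAlgCat.of R (R → R)]).hom (TallWraith.TW.gen f g) = g ∘ f) ∧
        ∃ (a : ∀ S : (Type u)ᵒᵖ, TallWraith.TWAction (TallWraith.CoAlgCat.of R (R → R))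
              ((TallWraith.con R).obj S))
          (Φ : (Type u)ᵒᵖ ⥤ TallWraith.TWMod (TallWraith.CoAlgCat.of R (R → R))),
          (∀ (S : (Type u)ᵒᵖ) (h : S.unop → R) (g : R → R), ((a S).act h).hom g = g ∘ h) ∧
          (∀ S : (Type u)ᵒᵖ, Φ.obj S = ⟨(TallWraith.con R).obj S, a S⟩) ∧
          Φ ⋙ TallWraith.TWMod.forget (TallWraith.CoAlgCat.of R (R → R)) =
            TallWraith.con R := by
  refine ⟨TallWraith.kunneth_bijective, TallWraith.functionCoAlg,
    fun _ => TallWraith.kunneth_coop, TallWraith.functionMonObj R,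
    TallWraith.functionOne_X, TallWraith.functionMul_gen,
    TallWraith.functionAction R, TallWraith.conMod R, fun _ _ _ => rfl, fun _ => rfl, rfl⟩
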